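/- Let $q$ be a prime. A $\mathbb{Z}_q$-order in $M_2(\mathbb{Q}_q)$ is a $\mathbb{Z}_q$-subalgebra that is finitely generated over $\mathbb{Z}_q$ and spans $M_2(\mathbb{Q}_q)$ over $\mathbb{Q}_q$; it is maximal if it is not properly contained in another order. The Bruhat-Tits tree is the graph whose vertices are the maximal orders of $M_2(\mathbb{Q}_q)$, where $\Lambda$ and $\Lambda'$ are joined by an edge if and only if $[\Lambda : \Lambda\cap\Lambda'] = [\Lambda' : \Lambda\cap\Lambda'] = q$; let $d$ denote the distance in this tree. For a finite nonempty set $S$ of maximal orders put $$d_3(S) := \max\{ d(\Lambda,\Lambda') + d(\Lambda',\Lambda'') + d(\Lambda'',\Lambda) : \Lambda,\Lambda',\Lambda''\in S\},$$ where $\Lambda,\Lambda',\Lambda''$ need not be distinct. Let $S = \{\Lambda_1,\Lambda_2,\Lambda_3\}$ be a set of (not necessarily distinct) maximal orders of $M_2(\mathbb{Q}_q)$, and let $\Lambda_4$ be a maximal order of $M_2(\mathbb{Q}_q)$ with $\Lambda_4 \supseteq \Lambda_1\cap\Lambda_2\cap\Lambda_3$. Then $d_3(S\cup\{\Lambda_4\})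 = d_3(S)$. -/

import Mathlib

/-- A `ℤ_q`-order in `M_2(ℚ_q)`: a `ℤ_q`-subalgebra that is a `ℤ_q`-lattice, i.e. it is finitely
generated over `ℤ_q` and spans `M_2(ℚ_q)` over `ℚ_q`. -/
def IsLocalOrder (q : ℕ) [Fact q.Prime]
    (Λ : Subalgebra ℤ_[q] (Matrix (Fin 2) (Fin 2) ℚ_[q])) : Prop :=
  Submodule.IsLattice ℚ_[q] (Subalgebra.toSubmodule Λ)

/-- The type of maximal orders of `M_2(ℚ_q)`: orders that are maximal with respect to inclusion. -/
abbrev MaxOrder (q : ℕ) [Fact q.Prime] : Type :=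
  {Λ : Subalgebra ℤ_[q] (Matrix (Fin 2) (Fin 2) ℚ_[q]) // Maximal (IsLocalOrder q) Λ}

noncomputable instance MaxOrder.instDecidableEq (q : ℕ) [Fact q.Prime] :
    DecidableEq (MaxOrder q) :=
  Classical.decEq _

/-- The index `[Λ : Λ ∩ Λ']` of additive groups (`0` if it is infinite). -/
noncomputable def MaxOrder.index {q : ℕ} [Fact q.Prime] (Λ Λ' : MaxOrder q) : ℕ :=
  (Λ.1 ⊓ Λ'.1).toSubring.toAddSubgroup.relIndex Λ.1.toSubring.toAddSubgroup

/-- The Bruhat-Tits tree of `GL_2(ℚ_q)`, with the maximal orders of `M_2(ℚ_q)` as vertices: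
`Λ` and `Λ'` are neighbours iff `[Λ : Λ ∩ Λ'] = [Λ' : Λ ∩ Λ'] = q`. -/
def bruhatTitsTree (q : ℕ) [Fact q.Prime] : SimpleGraph (MaxOrder q) where
  Adj Λ Λ' := MaxOrder.index Λ Λ' = q ∧ MaxOrder.index Λ' Λ = q
  symm := ⟨fun _ _ h => ⟨h.2, h.1⟩⟩
  loopless := ⟨fun Λ h => by
    have h1 := h.1
    simp only [MaxOrder.index, inf_idem, AddSubgroup.relIndex_self] at h1
    exact (Fact.out : q.Prime).one_lt.ne h1⟩

/-- `d_3(S)`: the maximum of `d(Λ₁, Λ₂) + d(Λ₂, Λ₃) + d(Λ₃, Λ₁)` over all, not necessarily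
distinct, `Λ₁, Λ₂, Λ₃ ∈ S`, where `d` is the distance in the Bruhat-Tits tree. -/
noncomputable def d₃ {q : ℕ} [Fact q.Prime] (S : Finset (MaxOrder q)) : ℕ :=
  S.sup fun Λ₁ => S.sup fun Λ₂ => S.sup fun Λ₃ =>
    (bruhatTitsTree q).dist Λ₁ Λ₂ + (bruhatTitsTree q).dist Λ₂ Λ₃ +
      (bruhatTitsTree q).dist Λ₃ Λ₁

/-! The group index of a triple intersection measures the perimeter of the triangle: `[Λ₁ : Λ₁ ∩ Λ₂
∩ Λ₃] = q ^ (p / 2)`, where `p` is the sum of the three distances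
(`MaxOrder.exists_relIndex_eq_pow`). If `Λ` and `Λ'` contain `Λ₁ ∩ Λ₂ ∩ Λ₃`, then so does `Λ₁ ∩ Λ ∩
Λ'`; its index in `Λ₁` is therefore no larger, and neither is the perimeter of `Λ₁, Λ, Λ'`. By
symmetry this holds for every triple from `S ∪ {Λ₄}` with a member in `S`; the only other triple is
`Λ₄, Λ₄, Λ₄`, of perimeter `0`.

The index formula is a computation in one basis `f₁, f₂` (`exists_common_basis`). Maximal orders are
endomorphism rings of lattices. Two of the lattices are diagonal in this basis, at positions `m` and
`n` on the line (apartment) it defines; the third is `⟨f₁ + f₂, c f₂⟩`, at distance `d = v(c)` from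
the line and branching off at `0`. All intersections needed are then given by divisibility
conditions on linear forms in the matrix entries, and half the perimeter is the length of the hull
of `m, n, 0` plus `d`. No tree property of the graph is used. -/

open scoped Matrix

/-! ### Maximal orders as endomorphism rings of lattices -/

/-- The `ℤ_q`-algebra automorphism `M ↦ g⁻¹ M g` of `M_2(ℚ_q)`. -/
noncomputable def conjEquiv {q : ℕ} [Fact q.Prime] (g : GL (Fin 2) ℚ_[q]) :
    Matrix (Fin 2) (Fin 2) ℚ_[q] ≃ₐ[ℤ_[q]] Matrix (Fin 2) (Fin 2) ℚ_[q] where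
  toFun M := (g⁻¹).1 * M * g.1
  invFun M := g.1 * M * (g⁻¹).1
  left_inv M := by
    have h : g.1 * (g⁻¹).1 = 1 := g.mul_inv
    calc g.1 * ((g⁻¹).1 * M * g.1) * (g⁻¹).1 = (g.1 * (g⁻¹).1) * M * (g.1 * (g⁻¹).1) := by
          simp only [Matrix.mul_assoc]
      _ = M := by rw [h, Matrix.one_mul, Matrix.mul_one]
  right_inv M := by
    have h : (g⁻¹).1 * g.1 = 1 := g.inv_mul
    calc (g⁻¹).1 * (g.1 * M * (g⁻¹).1) * g.1 = ((g⁻¹).1 * g.1) * M * ((g⁻¹).1 * g.1) := by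
          simp only [Matrix.mul_assoc]
      _ = M := by rw [h, Matrix.one_mul, Matrix.mul_one]
  map_mul' M N := by
    have h : g.1 * (g⁻¹).1 = 1 := g.mul_inv
    calc (g⁻¹).1 * (M * N) * g.1 = (g⁻¹).1 * M * 1 * N * g.1 := by
          simp only [Matrix.mul_assoc, Matrix.one_mul]
      _ = (g⁻¹).1 * M * g.1 * ((g⁻¹).1 * N * g.1) := by
          rw [← h]; simp only [Matrix.mul_assoc]
  map_add' M N := by rw [Matrix.mul_add, Matrix.add_mul]
  commutes' r := by
    have h : (g⁻¹).1 * g.1 = 1 := g.inv_mul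
    rw [Algebra.algebraMap_eq_smul_one, Matrix.mul_smul, Matrix.smul_mul, Matrix.mul_one, h]

section

variable {q : ℕ} [Fact q.Prime]

theorem conjEquiv_apply (g : GL (Fin 2) ℚ_[q]) (M : Matrix (Fin 2) (Fin 2) ℚ_[q]) :
    conjEquiv g M = (g⁻¹).1 * M * g.1 := rfl

theorem conjEquiv_mul (g h : GL (Fin 2) ℚ_[q]) (M : Matrix (Fin 2) (Fin 2) ℚ_[q]) :
    conjEquiv (g * h) M = conjEquiv h (conjEquiv g M) := by
  simp only [conjEquiv_apply, _root_.mul_inv_rev, Units.val_mul, Matrix.mul_assoc]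

theorem conjEquiv_inv (g : GL (Fin 2) ℚ_[q]) (M : Matrix (Fin 2) (Fin 2) ℚ_[q]) :
    conjEquiv g (conjEquiv g⁻¹ M) = M := by
  rw [← conjEquiv_mul, inv_mul_cancel]
  simp [conjEquiv_apply]

theorem conjEquiv_smul (g : GL (Fin 2) ℚ_[q]) (c : ℚ_[q]) (M : Matrix (Fin 2) (Fin 2) ℚ_[q]) :
    conjEquiv g (c • M) = c • conjEquiv g M := by
  simp [conjEquiv_apply]

theorem mul_eq_iff_conjEquiv_eq (g : GL (Fin 2) ℚ_[q]) (M N : Matrix (Fin 2) (Fin 2) ℚ_[q]) :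
    conjEquiv g M = N ↔ M * g.1 = g.1 * N := by
  have h : (g⁻¹).1 * g.1 = 1 := g.inv_mul
  have h' : g.1 * (g⁻¹).1 = 1 := g.mul_inv
  rw [conjEquiv_apply]
  constructor
  · rintro rfl
    rw [Matrix.mul_assoc, ← Matrix.mul_assoc g.1, h', Matrix.one_mul]
  · intro e
    rw [Matrix.mul_assoc, e, ← Matrix.mul_assoc, h, Matrix.one_mul]

/-- The order `M_2(ℤ_q)`. -/
def integralOrder (q : ℕ) [Fact q.Prime] : Subalgebra ℤ_[q] (Matrix (Fin 2) (Fin 2) ℚ_[q]) where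
  carrier := {M | ∀ i j, ‖M i j‖ ≤ 1}
  mul_mem' {M N} hM hN i j := by
    rw [Matrix.mul_apply]
    refine IsUltrametricDist.norm_sum_le_of_forall_le_of_nonneg zero_le_one fun k _ => ?_
    rw [norm_mul]
    exact mul_le_one₀ (hM i k) (norm_nonneg _) (hN k j)
  add_mem' {M N} hM hN i j :=
    (IsUltrametricDist.norm_add_le_max (M i j) (N i j)).trans (max_le (hM i j) (hN i j))
  algebraMap_mem' r i j := by
    rw [Matrix.algebraMap_matrix_apply]
    split_ifs
    · exact r.norm_le_one
    · simp

theorem mem_integralOrder {M : Matrix (Fin 2) (Fin 2) ℚ_[q]} :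
    M ∈ integralOrder q ↔ ∀ i j, ‖M i j‖ ≤ 1 := Iff.rfl

/-- The order `g M_2(ℤ_q) g⁻¹`, the endomorphism ring of the lattice spanned by the columns
of `g`. -/
noncomputable def latticeOrder (g : GL (Fin 2) ℚ_[q]) :
    Subalgebra ℤ_[q] (Matrix (Fin 2) (Fin 2) ℚ_[q]) :=
  (integralOrder q).comap (conjEquiv g).toAlgHom

theorem mem_latticeOrder {g : GL (Fin 2) ℚ_[q]} {M : Matrix (Fin 2) (Fin 2) ℚ_[q]} :
    M ∈ latticeOrder g ↔ conjEquiv g M ∈ integralOrder q := Iff.rfl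

theorem mem_latticeOrder_mul {g h : GL (Fin 2) ℚ_[q]} {M : Matrix (Fin 2) (Fin 2) ℚ_[q]} :
    M ∈ latticeOrder (g * h) ↔ conjEquiv g M ∈ latticeOrder h := by
  rw [mem_latticeOrder, mem_latticeOrder, conjEquiv_mul]

theorem isLocalOrder_integralOrder : IsLocalOrder q (integralOrder q) where
  fg := by
    have h : Subalgebra.toSubmodule (integralOrder q) =
        LinearMap.range ((Algebra.linearMap ℤ_[q] ℚ_[q]).mapMatrix (m := Fin 2) (n := Fin 2)) := by
      ext M
      constructor
      · intro hM
        refine ⟨Matrix.of fun i j => ⟨M i j, hM i j⟩, ?_⟩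
        ext i j
        rfl
      · rintro ⟨N, rfl⟩ i j
        exact (N i j).norm_le_one
    rw [h, ← Module.Finite.iff_fg]
    infer_instance
  span_eq_top := by
    rw [eq_top_iff]
    intro M _
    rw [Matrix.matrix_eq_sum_single M]
    refine Submodule.sum_mem _ fun i _ => Submodule.sum_mem _ fun j _ => ?_
    have h : Matrix.single i j (M i j) = M i j • Matrix.single i j (1 : ℚ_[q]) := by simp
    rw [h]
    refine Submodule.smul_mem _ _ (Submodule.subset_span fun k l => ?_)
    rw [Matrix.single_apply]
    split_ifs <;> simp

theorem IsLocalOrder.comap_conjEquiv {Λ : Subalgebra ℤ_[q] (Matrix (Fin 2) (Fin 2) ℚ_[q])}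
    (hΛ : IsLocalOrder q Λ) (g : GL (Fin 2) ℚ_[q]) :
    IsLocalOrder q (Λ.comap (conjEquiv g).toAlgHom) where
  fg := by
    have h : Subalgebra.toSubmodule (Λ.comap (conjEquiv g).toAlgHom) =
        (Subalgebra.toSubmodule Λ).map (conjEquiv g).symm.toLinearMap := by
      ext M
      constructor
      · intro hM
        exact ⟨conjEquiv g M, hM, (conjEquiv g).symm_apply_apply M⟩
      · rintro ⟨N, hN, rfl⟩
        change conjEquiv g ((conjEquiv g).symm N) ∈ Λ
        rw [AlgEquiv.apply_symm_apply]
        exact hN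
    rw [h]
    exact hΛ.fg.map _
  span_eq_top := by
    rw [eq_top_iff]
    intro M _
    have key : ∀ N ∈ Submodule.span ℚ_[q] (Subalgebra.toSubmodule Λ : Set _),
        conjEquiv g⁻¹ N ∈ Submodule.span ℚ_[q]
          (Subalgebra.toSubmodule (Λ.comap (conjEquiv g).toAlgHom) : Set _) := by
      intro N hN
      induction hN using Submodule.span_induction with
      | mem x hx =>
        refine Submodule.subset_span ?_
        change conjEquiv g (conjEquiv g⁻¹ x) ∈ Λ
        rw [conjEquiv_inv]
        exact hx
      | zero => simp
      | add x y _ _ hx hy => rw [map_add]; exact Submodule.add_mem _ hx hy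
      | smul c x _ hx => rw [conjEquiv_smul]; exact Submodule.smul_mem _ _ hx
    have h1 := key (conjEquiv g M) (by rw [hΛ.span_eq_top]; trivial)
    have h2 := conjEquiv_inv g⁻¹ M
    rw [inv_inv] at h2
    rwa [h2] at h1

theorem maximal_comap_conjEquiv {Λ : Subalgebra ℤ_[q] (Matrix (Fin 2) (Fin 2) ℚ_[q])}
    (hΛ : Maximal (IsLocalOrder q) Λ) (g : GL (Fin 2) ℚ_[q]) :
    Maximal (IsLocalOrder q) (Λ.comap (conjEquiv g).toAlgHom) := by
  refine ⟨hΛ.prop.comap_conjEquiv g, fun Λ' hΛ' hle M hM => ?_⟩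
  have h1 : Λ ≤ Λ'.comap (conjEquiv g⁻¹).toAlgHom := by
    intro N hN
    refine hle ?_
    change conjEquiv g (conjEquiv g⁻¹ N) ∈ Λ
    rwa [conjEquiv_inv]
  refine hΛ.le_of_ge (hΛ'.comap_conjEquiv g⁻¹) h1 ?_
  change conjEquiv g⁻¹ (conjEquiv g M) ∈ Λ'
  have h2 := conjEquiv_inv g⁻¹ M
  rw [inv_inv] at h2
  rwa [h2]

theorem isLocalOrder_latticeOrder (g : GL (Fin 2) ℚ_[q]) : IsLocalOrder q (latticeOrder g) :=
  isLocalOrder_integralOrder.comap_conjEquiv g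

/-- `Λ` stabilises the lattice `L = Λ e`, with `e` the first standard vector. The columns of `g`
form a `ℤ_q`-basis of `L`, and `M L ⊆ L` says that `g⁻¹ M g` is integral. -/
theorem IsLocalOrder.exists_le_latticeOrder
    {Λ : Subalgebra ℤ_[q] (Matrix (Fin 2) (Fin 2) ℚ_[q])} (hΛ : IsLocalOrder q Λ) :
    ∃ g : GL (Fin 2) ℚ_[q], Λ ≤ latticeOrder g := by
  let e : Fin 2 → ℚ_[q] := Pi.single 0 1
  let f : Matrix (Fin 2) (Fin 2) ℚ_[q] →ₗ[ℚ_[q]] (Fin 2 → ℚ_[q]) :=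
    { toFun := fun M => M *ᵥ e
      map_add' := fun M N => Matrix.add_mulVec M N e
      map_smul' := fun c M => Matrix.smul_mulVec c M e }
  let L : Submodule ℤ_[q] (Fin 2 → ℚ_[q]) :=
    (Subalgebra.toSubmodule Λ).map (f.restrictScalars ℤ_[q])
  have hL : Submodule.IsLattice ℚ_[q] L := by
    refine ⟨hΛ.fg.map _, ?_⟩
    have h1 : (L : Set (Fin 2 → ℚ_[q])) = f '' (Subalgebra.toSubmodule Λ : Set _) := rfl
    rw [h1, Submodule.span_image, hΛ.span_eq_top, Submodule.map_top, LinearMap.range_eq_top]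
    intro v
    refine ⟨Matrix.of fun i _ => v i, ?_⟩
    ext i
    simp [f, e]
  have hfree : Module.Free ℤ_[q] L := Submodule.IsLattice.free ℚ_[q] L
  let b : Module.Basis (Fin 2) ℤ_[q] L :=
    Module.finBasisOfFinrankEq ℤ_[q] L (by
      rw [Submodule.IsLattice.finrank_of_pi ℚ_[q] L, Fintype.card_fin])
  let B : Module.Basis (Fin 2) ℚ_[q] (Fin 2 → ℚ_[q]) := b.extendOfIsLattice ℚ_[q]
  let G : Matrix (Fin 2) (Fin 2) ℚ_[q] := (Pi.basisFun ℚ_[q] (Fin 2)).toMatrix B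
  have hG : IsUnit G := by
    have := (Pi.basisFun ℚ_[q] (Fin 2)).invertibleToMatrix B
    exact isUnit_of_invertible _
  obtain ⟨g, hg⟩ := hG
  have hcol : ∀ i j, g.1 i j = (b j : Fin 2 → ℚ_[q]) i := by
    intro i j
    rw [hg]
    simp [G, B, Module.Basis.toMatrix_apply]
  refine ⟨g, fun M hM => ?_⟩
  have hML : ∀ v ∈ L, M *ᵥ v ∈ L := by
    rintro _ ⟨N, hN, rfl⟩
    refine ⟨M * N, Λ.mul_mem hM hN, ?_⟩
    exact (Matrix.mulVec_mulVec e M N).symm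
  let C : Matrix (Fin 2) (Fin 2) ℤ_[q] := Matrix.of fun i j => b.repr ⟨_, hML _ (b j).2⟩ i
  rw [mem_latticeOrder, (mul_eq_iff_conjEquiv_eq g M (C.map (fun x : ℤ_[q] => (x : ℚ_[q])))).2]
  · exact fun i j => (C i j).norm_le_one
  · ext i j
    have h1 := b.sum_repr ⟨_, hML _ (b j).2⟩
    have h2 := congrArg (fun v : L => (v : Fin 2 → ℚ_[q]) i) h1
    simp only [Fin.sum_univ_two] at h2
    have h3 : (M * g.1) i j = (M *ᵥ (b j : Fin 2 → ℚ_[q])) i := by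
      simp [Matrix.mul_apply, Matrix.mulVec, dotProduct, hcol]
    rw [h3, ← h2]
    simp only [Matrix.mul_apply, Fin.sum_univ_two, hcol, C, Matrix.map_apply, Matrix.of_apply]
    rw [mul_comm, mul_comm ((b 1 : Fin 2 → ℚ_[q]) i)]
    rfl

theorem exists_eq_latticeOrder {Λ : Subalgebra ℤ_[q] (Matrix (Fin 2) (Fin 2) ℚ_[q])}
    (hΛ : Maximal (IsLocalOrder q) Λ) : ∃ g : GL (Fin 2) ℚ_[q], Λ = latticeOrder g := by
  obtain ⟨g, hg⟩ := hΛ.prop.exists_le_latticeOrder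
  exact ⟨g, hΛ.eq_of_le (isLocalOrder_latticeOrder g) hg⟩

/-- All lattice orders are conjugate, so maximality passes from one to all. Since any given maximal
order is a lattice order, the maximality of `M_2(ℤ_q)` needs no separate proof. -/
theorem maximal_latticeOrder_of_maximal {g : GL (Fin 2) ℚ_[q]}
    (hg : Maximal (IsLocalOrder q) (latticeOrder g)) (h : GL (Fin 2) ℚ_[q]) :
    Maximal (IsLocalOrder q) (latticeOrder h) := by
  have h1 := maximal_comap_conjEquiv hg (h * g⁻¹)
  convert h1 using 1
  ext M
  change _ ↔ conjEquiv g (conjEquiv (h * g⁻¹) M) ∈ integralOrder q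
  rw [← conjEquiv_mul, inv_mul_cancel_right, mem_latticeOrder]

end

/-! ### Matrix decompositions and a common basis for three lattices -/

section

variable {q : ℕ} [Fact q.Prime]

/-- The group `GL_2(ℤ_q)` inside `GL_2(ℚ_q)`. -/
def integralGL (q : ℕ) [Fact q.Prime] : Subgroup (GL (Fin 2) ℚ_[q]) where
  carrier := {k | k.1 ∈ integralOrder q ∧ (k⁻¹).1 ∈ integralOrder q}
  mul_mem' {k l} hk hl := by
    refine ⟨(integralOrder q).mul_mem hk.1 hl.1, ?_⟩
    rw [_root_.mul_inv_rev]
    exact (integralOrder q).mul_mem hl.2 hk.2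
  one_mem' := by
    refine ⟨(integralOrder q).one_mem, ?_⟩
    rw [inv_one]
    exact (integralOrder q).one_mem
  inv_mem' {k} hk := ⟨hk.2, by rw [inv_inv]; exact hk.1⟩

theorem latticeOrder_mul_of_mem {k : GL (Fin 2) ℚ_[q]} (hk : k ∈ integralGL q)
    (g : GL (Fin 2) ℚ_[q]) : latticeOrder (g * k) = latticeOrder g := by
  have key : ∀ l ∈ integralGL q, ∀ M ∈ integralOrder q, conjEquiv l M ∈ integralOrder q :=
    fun l hl M hM => (integralOrder q).mul_mem ((integralOrder q).mul_mem hl.2 hM) hl.1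
  ext M
  rw [mem_latticeOrder, mem_latticeOrder, conjEquiv_mul]
  refine ⟨fun h => ?_, key k hk _⟩
  have h1 := key k⁻¹ (inv_mem hk) _ h
  rwa [← conjEquiv_mul, mul_inv_cancel, show conjEquiv 1 (conjEquiv g M) = conjEquiv g M by
    simp [conjEquiv_apply]] at h1

theorem mem_integralGL_of_mul_eq_one {k : GL (Fin 2) ℚ_[q]} {N : Matrix (Fin 2) (Fin 2) ℚ_[q]}
    (hk : k.1 ∈ integralOrder q) (hN : N ∈ integralOrder q) (h : k.1 * N = 1) :
    k ∈ integralGL q := by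
  refine ⟨hk, ?_⟩
  rw [Units.inv_eq_of_mul_eq_one_right h]
  exact hN

theorem mem_integralOrder_of {a b c d : ℚ_[q]} :
    !![a, b; c, d] ∈ integralOrder q ↔ ‖a‖ ≤ 1 ∧ ‖b‖ ≤ 1 ∧ ‖c‖ ≤ 1 ∧ ‖d‖ ≤ 1 := by
  simp [mem_integralOrder, Fin.forall_fin_two, and_assoc]

/-- The matrix `[[p, 0], [x, r]]`. -/
noncomputable def lowerGL (p x r : ℚ_[q]) (hp : p ≠ 0) (hr : r ≠ 0) : GL (Fin 2) ℚ_[q] :=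
  Matrix.GeneralLinearGroup.mkOfDetNeZero !![p, 0; x, r] (by simp [hp, hr])

theorem lowerGL_val (p x r : ℚ_[q]) (hp : p ≠ 0) (hr : r ≠ 0) :
    (lowerGL p x r hp hr).1 = !![p, 0; x, r] := rfl

/-- The matrix `[[1, y], [0, 1]]`. -/
noncomputable def upperUnipotentGL (y : ℚ_[q]) : GL (Fin 2) ℚ_[q] :=
  Matrix.GeneralLinearGroup.mkOfDetNeZero !![1, y; 0, 1] (by simp)

/-- The matrix `[[0, 1], [1, 0]]`. -/
noncomputable def swapGL (q : ℕ) [Fact q.Prime] : GL (Fin 2) ℚ_[q] :=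
  Matrix.GeneralLinearGroup.mkOfDetNeZero !![0, 1; 1, 0] (by simp)

theorem swapGL_val : (swapGL q).1 = !![0, 1; 1, 0] := rfl

theorem upperUnipotentGL_mem {y : ℚ_[q]} (hy : ‖y‖ ≤ 1) : upperUnipotentGL y ∈ integralGL q := by
  refine mem_integralGL_of_mul_eq_one (N := !![1, -y; 0, 1]) ?_ ?_ ?_
  · exact mem_integralOrder_of.2 (by simpa using hy)
  · exact mem_integralOrder_of.2 (by simpa using hy)
  · simp [upperUnipotentGL, Matrix.GeneralLinearGroup.mkOfDetNeZero, Matrix.one_fin_two]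

theorem lowerGL_mem {y : ℚ_[q]} (hy : ‖y‖ ≤ 1) :
    lowerGL 1 y 1 one_ne_zero one_ne_zero ∈ integralGL q := by
  refine mem_integralGL_of_mul_eq_one (N := !![1, 0; -y, 1]) ?_ ?_ ?_
  · exact mem_integralOrder_of.2 (by simpa using hy)
  · exact mem_integralOrder_of.2 (by simpa using hy)
  · simp [lowerGL_val, Matrix.one_fin_two]

theorem swapGL_mul_swapGL : swapGL q * swapGL q = 1 := by
  apply Units.ext
  simp [swapGL_val, Matrix.one_fin_two]

theorem swapGL_mul_apply_zero (h : GL (Fin 2) ℚ_[q]) (j : Fin 2) :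
    (swapGL q * h).1 0 j = h.1 1 j := by
  rw [Units.val_mul, Matrix.mul_apply]
  simp [swapGL_val]

theorem swapGL_mul_apply_one (h : GL (Fin 2) ℚ_[q]) (j : Fin 2) :
    (swapGL q * h).1 1 j = h.1 0 j := by
  rw [Units.val_mul, Matrix.mul_apply]
  simp [swapGL_val]

theorem mul_swapGL_apply_zero (h : GL (Fin 2) ℚ_[q]) (i : Fin 2) :
    (h * swapGL q).1 i 0 = h.1 i 1 := by
  rw [Units.val_mul, Matrix.mul_apply]
  simp [swapGL_val]

theorem mul_swapGL_apply_one (h : GL (Fin 2) ℚ_[q]) (i : Fin 2) :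
    (h * swapGL q).1 i 1 = h.1 i 0 := by
  rw [Units.val_mul, Matrix.mul_apply]
  simp [swapGL_val]

theorem swapGL_mem : swapGL q ∈ integralGL q := by
  refine mem_integralGL_of_mul_eq_one (N := (swapGL q).1) ?_ ?_ ?_
  · exact mem_integralOrder_of.2 (by simp)
  · exact mem_integralOrder_of.2 (by simp)
  · rw [← Units.val_mul, swapGL_mul_swapGL, Units.val_one]

/-- The top left entry divides the top right one, so an integral column operation clears the latter.
-/
theorem exists_lowerGL_mul_of_norm_le {h : GL (Fin 2) ℚ_[q]} (hle : ‖h.1 0 1‖ ≤ ‖h.1 0 0‖) :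
    ∃ (p r : ℚ_[q]) (hp : p ≠ 0) (hr : r ≠ 0), ∃ k ∈ integralGL q,
      p = h.1 0 0 ∧ h = lowerGL p (h.1 1 0) r hp hr * k := by
  have hdet : h.1 0 0 * h.1 1 1 - h.1 0 1 * h.1 1 0 ≠ 0 := by
    rw [← Matrix.det_fin_two]
    exact ((Matrix.isUnit_iff_isUnit_det _).1 h.isUnit).ne_zero
  have hp : h.1 0 0 ≠ 0 := by
    intro h0
    rw [h0, norm_zero, norm_le_zero_iff] at hle
    rw [h0, hle] at hdet
    simp at hdet
  refine ⟨h.1 0 0, h.1 1 1 - h.1 0 1 * h.1 1 0 / h.1 0 0, hp, ?_,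
    upperUnipotentGL (h.1 0 1 / h.1 0 0), upperUnipotentGL_mem ?_, rfl, ?_⟩
  · intro h0
    apply hdet
    field_simp at h0
    linear_combination h0
  · rw [norm_div]
    exact div_le_one_of_le₀ hle (norm_nonneg _)
  · apply Units.ext
    rw [Units.val_mul, lowerGL_val]
    conv_lhs => rw [Matrix.eta_fin_two h.1]
    change _ = !![h.1 0 0, 0; h.1 1 0, _] * !![1, h.1 0 1 / h.1 0 0; 0, 1]
    rw [Matrix.mul_fin_two]
    congr 1
    ext i j
    fin_cases i <;> fin_cases j <;> simp <;> field_simp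
    ring

theorem exists_lowerGL_mul (h : GL (Fin 2) ℚ_[q]) :
    ∃ (p x r : ℚ_[q]) (hp : p ≠ 0) (hr : r ≠ 0), ∃ k ∈ integralGL q,
      h = lowerGL p x r hp hr * k := by
  rcases le_total ‖h.1 0 1‖ ‖h.1 0 0‖ with hle | hle
  · obtain ⟨p, r, hp, hr, k, hk, -, e⟩ := exists_lowerGL_mul_of_norm_le hle
    exact ⟨p, _, r, hp, hr, k, hk, e⟩
  · obtain ⟨p, r, hp, hr, k, hk, -, e⟩ :=
      exists_lowerGL_mul_of_norm_le (h := h * swapGL q)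
        (by simpa only [swapGL_mul_apply_zero, swapGL_mul_apply_one, mul_swapGL_apply_zero,
          mul_swapGL_apply_one] using hle)
    refine ⟨p, (h * swapGL q).1 1 0, r, hp, hr, k * swapGL q, mul_mem hk swapGL_mem, ?_⟩
    rw [← mul_assoc, ← e, mul_assoc, swapGL_mul_swapGL, mul_one]

theorem exists_cartan_of_norm_le {h : GL (Fin 2) ℚ_[q]} (h01 : ‖h.1 0 1‖ ≤ ‖h.1 0 0‖)
    (h10 : ‖h.1 1 0‖ ≤ ‖h.1 0 0‖) :
    ∃ (s t : ℚ_[q]) (hs : s ≠ 0) (ht : t ≠ 0), ∃ k ∈ integralGL q, ∃ l ∈ integralGL q,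
      h = k * lowerGL s 0 t hs ht * l := by
  obtain ⟨p, r, hp, hr, l, hl, e, he⟩ := exists_lowerGL_mul_of_norm_le h01
  refine ⟨p, r, hp, hr, lowerGL 1 (h.1 1 0 / p) 1 one_ne_zero one_ne_zero, lowerGL_mem ?_, l, hl,
    ?_⟩
  · rw [norm_div, e]
    exact div_le_one_of_le₀ h10 (norm_nonneg _)
  · conv_lhs => rw [he]
    congr 1
    apply Units.ext
    simp [lowerGL_val, hp]

/-- The Cartan decomposition of `GL_2(ℚ_q)`. -/
theorem exists_cartan (h : GL (Fin 2) ℚ_[q]) :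
    ∃ (s t : ℚ_[q]) (hs : s ≠ 0) (ht : t ≠ 0), ∃ k ∈ integralGL q, ∃ l ∈ integralGL q,
      h = k * lowerGL s 0 t hs ht * l := by
  have right : ∀ h : GL (Fin 2) ℚ_[q], (∃ (s t : ℚ_[q]) (hs : s ≠ 0) (ht : t ≠ 0),
      ∃ k ∈ integralGL q, ∃ l ∈ integralGL q, h * swapGL q = k * lowerGL s 0 t hs ht * l) →
      ∃ (s t : ℚ_[q]) (hs : s ≠ 0) (ht : t ≠ 0), ∃ k ∈ integralGL q, ∃ l ∈ integralGL q,
        h = k * lowerGL s 0 t hs ht * l := by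
    rintro h ⟨s, t, hs, ht, k, hk, l, hl, e⟩
    refine ⟨s, t, hs, ht, k, hk, l * swapGL q, mul_mem hl swapGL_mem, ?_⟩
    rw [← mul_assoc, ← e, mul_assoc, swapGL_mul_swapGL, mul_one]
  have left : ∀ h : GL (Fin 2) ℚ_[q], (∃ (s t : ℚ_[q]) (hs : s ≠ 0) (ht : t ≠ 0),
      ∃ k ∈ integralGL q, ∃ l ∈ integralGL q, swapGL q * h = k * lowerGL s 0 t hs ht * l) →
      ∃ (s t : ℚ_[q]) (hs : s ≠ 0) (ht : t ≠ 0), ∃ k ∈ integralGL q, ∃ l ∈ integralGL q,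
        h = k * lowerGL s 0 t hs ht * l := by
    rintro h ⟨s, t, hs, ht, k, hk, l, hl, e⟩
    refine ⟨s, t, hs, ht, swapGL q * k, mul_mem swapGL_mem hk, l, hl, ?_⟩
    rw [mul_assoc, mul_assoc, ← mul_assoc k, ← e, ← mul_assoc, swapGL_mul_swapGL, one_mul]
  -- Row and column swaps lie in `integralGL q`; they bring an entry of largest norm to the top
  -- left.
  rcases le_total (max ‖h.1 0 0‖ ‖h.1 1 1‖) (max ‖h.1 0 1‖ ‖h.1 1 0‖) with h1 | h1
  · rcases le_total ‖h.1 0 1‖ ‖h.1 1 0‖ with h2 | h2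
    · rw [max_eq_right h2] at h1
      apply left
      apply exists_cartan_of_norm_le
      · simpa only [swapGL_mul_apply_zero, swapGL_mul_apply_one, mul_swapGL_apply_zero,
          mul_swapGL_apply_one] using (le_max_right _ _).trans h1
      · simpa only [swapGL_mul_apply_zero, swapGL_mul_apply_one, mul_swapGL_apply_zero,
          mul_swapGL_apply_one] using (le_max_left _ _).trans h1
    · rw [max_eq_left h2] at h1
      apply right
      apply exists_cartan_of_norm_le
      · simpa only [swapGL_mul_apply_zero, swapGL_mul_apply_one, mul_swapGL_apply_zero,
          mul_swapGL_apply_one] using (le_max_left _ _).trans h1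
      · simpa only [swapGL_mul_apply_zero, swapGL_mul_apply_one, mul_swapGL_apply_zero,
          mul_swapGL_apply_one] using (le_max_right _ _).trans h1
  · rcases le_total ‖h.1 0 0‖ ‖h.1 1 1‖ with h2 | h2
    · rw [max_eq_right h2] at h1
      apply left
      apply right
      apply exists_cartan_of_norm_le
      · simpa only [swapGL_mul_apply_zero, swapGL_mul_apply_one, mul_swapGL_apply_zero,
          mul_swapGL_apply_one] using (le_max_right _ _).trans h1
      · simpa only [swapGL_mul_apply_zero, swapGL_mul_apply_one, mul_swapGL_apply_zero,
          mul_swapGL_apply_one] using (le_max_left _ _).trans h1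
    · rw [max_eq_left h2] at h1
      exact exists_cartan_of_norm_le ((le_max_left _ _).trans h1) ((le_max_right _ _).trans h1)

/-- If `r` divides `x`, an integral column operation replaces `x` by `r`. Having `x ≠ 0` allows
rescaling the basis by `diag(p, x)` below. -/
theorem exists_lowerGL_mul_of_ne_zero (h : GL (Fin 2) ℚ_[q]) :
    ∃ (p x r : ℚ_[q]) (hp : p ≠ 0) (_ : x ≠ 0) (hr : r ≠ 0), ‖r‖ ≤ ‖x‖ ∧ ∃ k ∈ integralGL q,
      h = lowerGL p x r hp hr * k := by
  obtain ⟨p, x, r, hp, hr, k, hk, e⟩ := exists_lowerGL_mul h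
  rcases le_total ‖r‖ ‖x‖ with hle | hle
  · refine ⟨p, x, r, hp, ?_, hr, hle, k, hk, e⟩
    rintro rfl
    rw [norm_zero, norm_le_zero_iff] at hle
    exact hr hle
  · refine ⟨p, r, r, hp, hr, hr, le_rfl,
      lowerGL 1 (x / r - 1) 1 one_ne_zero one_ne_zero * k, mul_mem (lowerGL_mem ?_) hk, ?_⟩
    · rw [sub_eq_add_neg]
      refine (Padic.nonarchimedean _ _).trans (max_le ?_ (by simp))
      rw [norm_div]
      exact div_le_one_of_le₀ hle (norm_nonneg _)
    · rw [e, ← mul_assoc]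
      congr 1
      apply Units.ext
      simp [lowerGL_val]
      field_simp
      ring

/-- Three lattice orders have, in a suitable basis `f₁, f₂`, the lattices `⟨s₁ f₁, t₁ f₂⟩`,
`⟨s₂ f₁, t₂ f₂⟩` and `⟨f₁ + f₂, c f₂⟩` with `c` integral. -/
theorem exists_common_basis (g₁ g₂ g₃ : GL (Fin 2) ℚ_[q]) :
    ∃ (g : GL (Fin 2) ℚ_[q]) (s₁ t₁ s₂ t₂ c : ℚ_[q]) (hs₁ : s₁ ≠ 0) (ht₁ : t₁ ≠ 0) (hs₂ : s₂ ≠ 0)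
      (ht₂ : t₂ ≠ 0) (hc : c ≠ 0), ‖c‖ ≤ 1 ∧
      latticeOrder g₁ = latticeOrder (g * lowerGL s₁ 0 t₁ hs₁ ht₁) ∧
      latticeOrder g₂ = latticeOrder (g * lowerGL s₂ 0 t₂ hs₂ ht₂) ∧
      latticeOrder g₃ = latticeOrder (g * lowerGL 1 1 c one_ne_zero hc) := by
  -- In the basis `g₁ k` the first two lattices are diagonal. Rescaling it by `diag(p, x)` keeps
  -- them diagonal and turns the column `(p, x)` of the third into `(1, 1)`, with `c = r / x`.
  obtain ⟨s, t, hs, ht, k, hk, l, hl, e⟩ := exists_cartan (g₁⁻¹ * g₂)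
  obtain ⟨p, x, r, hp, hx, hr, hle, m, hm, e'⟩ :=
    exists_lowerGL_mul_of_ne_zero ((g₁ * k)⁻¹ * g₃)
  refine ⟨g₁ * k * lowerGL p 0 x hp hx, p⁻¹, x⁻¹, p⁻¹ * s, x⁻¹ * t, r / x, inv_ne_zero hp,
    inv_ne_zero hx, mul_ne_zero (inv_ne_zero hp) hs, mul_ne_zero (inv_ne_zero hx) ht,
    div_ne_zero hr hx, ?_, ?_, ?_, ?_⟩
  · rw [norm_div]
    exact div_le_one_of_le₀ hle (norm_nonneg _)
  · have h1 : lowerGL p 0 x hp hx * lowerGL p⁻¹ 0 x⁻¹ (inv_ne_zero hp) (inv_ne_zero hx) = 1 := by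
      apply Units.ext
      simp [lowerGL_val, hp, hx, Matrix.one_fin_two]
    rw [mul_assoc _ (lowerGL p 0 x hp hx), h1, mul_one, latticeOrder_mul_of_mem hk]
  · have h1 : lowerGL p 0 x hp hx * lowerGL (p⁻¹ * s) 0 (x⁻¹ * t)
        (mul_ne_zero (inv_ne_zero hp) hs) (mul_ne_zero (inv_ne_zero hx) ht) =
        lowerGL s 0 t hs ht := by
      apply Units.ext
      simp [lowerGL_val, hp, hx]
    rw [mul_assoc _ (lowerGL p 0 x hp hx), h1, ← latticeOrder_mul_of_mem hl (_ * _), mul_assoc,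
      mul_assoc, ← mul_assoc k, ← e, mul_inv_cancel_left]
  · have h1 : lowerGL p 0 x hp hx * lowerGL 1 1 (r / x) one_ne_zero (div_ne_zero hr hx) =
        lowerGL p x r hp hr := by
      apply Units.ext
      simp [lowerGL_val, mul_div_cancel₀, hx]
    rw [mul_assoc _ (lowerGL p 0 x hp hx), h1, ← latticeOrder_mul_of_mem hm (_ * _), mul_assoc (g₁ * k),
      ← e', mul_inv_cancel_left]

end

/-! ### Indices of groups cut out by divisibility of linear forms -/

section

variable {q : ℕ} [Fact q.Prime]

/-- The additive group `q ^ n ℤ_q`. -/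
def padicBall (q : ℕ) [Fact q.Prime] (n : ℤ) : AddSubgroup ℚ_[q] where
  carrier := {y | ‖y‖ ≤ (q : ℝ) ^ (-n)}
  add_mem' {x y} hx hy := (Padic.nonarchimedean x y).trans (max_le hx hy)
  zero_mem' := by
    change ‖(0 : ℚ_[q])‖ ≤ _
    rw [norm_zero]
    positivity
  neg_mem' {x} hx := by
    change ‖-x‖ ≤ _
    rw [norm_neg]
    exact hx

theorem mem_padicBall {n : ℤ} {y : ℚ_[q]} : y ∈ padicBall q n ↔ ‖y‖ ≤ (q : ℝ) ^ (-n) := Iff.rfl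

theorem one_lt_cast_prime : (1 : ℝ) < q := by
  exact_mod_cast (Fact.out : q.Prime).one_lt

theorem padicBall_anti {m n : ℤ} (h : m ≤ n) : padicBall q n ≤ padicBall q m := fun _ hy =>
  le_trans (mem_padicBall.1 hy) (zpow_le_zpow_right₀ one_lt_cast_prime.le (by lia))

theorem padicBall_inf (m n : ℤ) : padicBall q m ⊓ padicBall q n = padicBall q (max m n) := by
  rcases le_total m n with h | h
  · rw [max_eq_right h, inf_eq_right.2 (padicBall_anti h)]
  · rw [max_eq_left h, inf_eq_left.2 (padicBall_anti h)]

theorem norm_prime_zpow (n : ℤ) : ‖(q : ℚ_[q]) ^ n‖ = (q : ℝ) ^ (-n) := by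
  rw [norm_zpow, Padic.norm_p, inv_zpow, zpow_neg]

theorem prime_zpow_ne_zero (n : ℤ) : (q : ℚ_[q]) ^ n ≠ 0 := by
  refine zpow_ne_zero _ ?_
  exact_mod_cast (Fact.out : q.Prime).ne_zero

theorem map_mulLeft_padicBall (i n : ℤ) :
    (padicBall q n).map (AddMonoidHom.mulLeft ((q : ℚ_[q]) ^ i)) = padicBall q (i + n) := by
  have h0 : (q : ℝ) ≠ 0 := (zero_lt_one.trans one_lt_cast_prime).ne'
  ext y
  constructor
  · rintro ⟨x, hx, rfl⟩
    rw [mem_padicBall, AddMonoidHom.coe_mulLeft, norm_mul, norm_prime_zpow, neg_add, zpow_add₀ h0]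
    exact mul_le_mul_of_nonneg_left hx (by positivity)
  · intro hy
    refine ⟨(q : ℚ_[q]) ^ (-i) * y, ?_, ?_⟩
    · change ‖_‖ ≤ _
      rw [norm_mul, norm_prime_zpow, show -n = - -i + -(i + n) by ring, zpow_add₀ h0]
      exact mul_le_mul_of_nonneg_left hy (by positivity)
    · rw [AddMonoidHom.coe_mulLeft, ← mul_assoc, zpow_neg, mul_inv_cancel₀ (prime_zpow_ne_zero i),
        one_mul]

/-- Inside `ℤ_q` the ball is the kernel of the surjection onto `ℤ/q ^ n`. -/
theorem relIndex_padicBall_zero (n : ℕ) :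
    (padicBall q n).relIndex (padicBall q 0) = q ^ n := by
  let f : ℤ_[q] →+ ℚ_[q] := PadicInt.Coe.ringHom.toAddMonoidHom
  have h0 : padicBall q 0 = (⊤ : AddSubgroup ℤ_[q]).map f := by
    ext y
    constructor
    · intro hy
      exact ⟨⟨y, by simpa [mem_padicBall] using hy⟩, trivial, rfl⟩
    · rintro ⟨x, -, rfl⟩
      change ‖x‖ ≤ _
      simpa using x.norm_le_one
  have h1 : (padicBall q n).comap f = (PadicInt.toZModPow (p := q) n).toAddMonoidHom.ker := by
    ext x
    rw [AddMonoidHom.mem_ker, AddSubgroup.mem_comap, mem_padicBall]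
    change ‖x‖ ≤ _ ↔ PadicInt.toZModPow n x = 0
    rw [PadicInt.norm_le_pow_iff_mem_span_pow, ← PadicInt.ker_toZModPow, RingHom.mem_ker]
  rw [h0, ← AddSubgroup.relIndex_comap, h1, AddSubgroup.relIndex_top_right,
    AddSubgroup.index_ker, AddMonoidHom.range_eq_top.2 (ZMod.ringHom_surjective _),
    AddSubgroup.card_top, Nat.card_zmod]

theorem relIndex_padicBall {i j : ℤ} (h : i ≤ j) :
    (padicBall q j).relIndex (padicBall q i) = q ^ (j - i).toNat := by
  have h1 := map_mulLeft_padicBall (q := q) i (j - i).toNat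
  have h2 := map_mulLeft_padicBall (q := q) i 0
  rw [show i + ((j - i).toNat : ℤ) = j by lia] at h1
  rw [add_zero] at h2
  rw [← h1, ← h2, AddSubgroup.relIndex_map_map_of_injective _ _ (mul_right_injective₀
    (prime_zpow_ne_zero i)), relIndex_padicBall_zero]

/-- The basic counting tool: the later indices are found by imposing one such condition at a time.
-/
theorem relIndex_inf_comap_padicBall {V : Type*} [AddGroup V] {φ : V →+ ℚ_[q]}
    {H : AddSubgroup V} {i j : ℤ} (hφ : H.map φ = padicBall q i) (h : i ≤ j) :
    (H ⊓ (padicBall q j).comap φ).relIndex H = q ^ (j - i).toNat := by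
  rw [AddSubgroup.inf_relIndex_left, AddSubgroup.relIndex_comap, hφ, relIndex_padicBall h]

/-- The linear form `M ↦ M i j`. -/
noncomputable def entryHom (q : ℕ) [Fact q.Prime] (i j : Fin 2) : Matrix (Fin 2) (Fin 2) ℚ_[q] →+ ℚ_[q] where
  toFun M := M i j
  map_zero' := rfl
  map_add' _ _ := rfl

/-- The linear form `[[x, y], [z, w]] ↦ z + w - x - y`, whose vanishing means that `e₁ + e₂` is
an eigenvector. -/
noncomputable def diagonalForm (q : ℕ) [Fact q.Prime] : Matrix (Fin 2) (Fin 2) ℚ_[q] →+ ℚ_[q] :=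
  entryHom q 1 0 + entryHom q 1 1 - entryHom q 0 0 - entryHom q 0 1

theorem diagonalForm_apply (M : Matrix (Fin 2) (Fin 2) ℚ_[q]) :
    diagonalForm q M = M 1 0 + M 1 1 - M 0 0 - M 0 1 := rfl

/-- The group of matrices `[[x, y], [z, w]]` with `x, w ∈ ℤ_q`, `y ∈ q ^ i ℤ_q` and
`z ∈ q ^ j ℤ_q`. -/
noncomputable def matrixBox (q : ℕ) [Fact q.Prime] (i j : ℤ) :
    AddSubgroup (Matrix (Fin 2) (Fin 2) ℚ_[q]) :=
  (padicBall q 0).comap (entryHom q 0 0) ⊓ (padicBall q 0).comap (entryHom q 1 1) ⊓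
    (padicBall q i).comap (entryHom q 0 1) ⊓ (padicBall q j).comap (entryHom q 1 0)

theorem mem_matrixBox {i j : ℤ} {M : Matrix (Fin 2) (Fin 2) ℚ_[q]} :
    M ∈ matrixBox q i j ↔ M 0 0 ∈ padicBall q 0 ∧ M 1 1 ∈ padicBall q 0 ∧
      M 0 1 ∈ padicBall q i ∧ M 1 0 ∈ padicBall q j := by
  simp only [matrixBox, AddSubgroup.mem_inf, AddSubgroup.mem_comap, and_assoc]
  rfl

theorem matrixBox_inf (i j k l : ℤ) :
    matrixBox q i j ⊓ matrixBox q k l = matrixBox q (max i k) (max j l) := by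
  ext M
  simp only [AddSubgroup.mem_inf, mem_matrixBox, ← padicBall_inf]
  tauto

theorem of_mem_matrixBox {i j : ℤ} {x y z w : ℚ_[q]} (hx : x ∈ padicBall q 0)
    (hy : y ∈ padicBall q i) (hz : z ∈ padicBall q j) (hw : w ∈ padicBall q 0) :
    !![x, y; z, w] ∈ matrixBox q i j := mem_matrixBox.2 ⟨hx, hw, hy, hz⟩

theorem map_entryHom_matrixBox_zero_one (i j : ℤ) :
    (matrixBox q i j).map (entryHom q 0 1) = padicBall q i := by
  ext y
  constructor
  · rintro ⟨M, hM, rfl⟩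
    exact (mem_matrixBox.1 hM).2.2.1
  · intro hy
    exact ⟨!![0, y; 0, 0], of_mem_matrixBox (zero_mem _) hy (zero_mem _) (zero_mem _), rfl⟩

theorem map_entryHom_matrixBox_one_zero (i j : ℤ) :
    (matrixBox q i j).map (entryHom q 1 0) = padicBall q j := by
  ext y
  constructor
  · rintro ⟨M, hM, rfl⟩
    exact (mem_matrixBox.1 hM).2.2.2
  · intro hy
    exact ⟨!![0, 0; y, 0], of_mem_matrixBox (zero_mem _) (zero_mem _) hy (zero_mem _), rfl⟩

/-- The entry `w` alone already takes all values in `ℤ_q`; `i, j ≥ 0` keeps the other terms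
integral. -/
theorem map_diagonalForm_matrixBox {i j : ℤ} (hi : 0 ≤ i) (hj : 0 ≤ j) :
    (matrixBox q i j).map (diagonalForm q) = padicBall q 0 := by
  ext y
  constructor
  · rintro ⟨M, hM, rfl⟩
    obtain ⟨h1, h2, h3, h4⟩ := mem_matrixBox.1 hM
    rw [diagonalForm_apply]
    exact sub_mem (sub_mem (add_mem (padicBall_anti hj h4) h2) h1) (padicBall_anti hi h3)
  · intro hy
    exact ⟨!![0, 0; 0, y], of_mem_matrixBox (zero_mem _) (zero_mem _) (zero_mem _) hy,
      by simp [diagonalForm_apply]⟩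

theorem relIndex_matrixBox {i j k l : ℤ} (hik : i ≤ k) (hjl : j ≤ l) :
    (matrixBox q k l).relIndex (matrixBox q i j) = q ^ (k - i + (l - j)).toNat := by
  have h1 : matrixBox q k j = matrixBox q i j ⊓ (padicBall q k).comap (entryHom q 0 1) := by
    ext M
    rw [AddSubgroup.mem_inf, mem_matrixBox, mem_matrixBox, AddSubgroup.mem_comap]
    change _ ↔ _ ∧ M 0 1 ∈ padicBall q k
    have := @padicBall_anti q _ _ _ hik (M 0 1)
    tauto
  have h2 : matrixBox q k l = matrixBox q k j ⊓ (padicBall q l).comap (entryHom q 1 0) := by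
    ext M
    rw [AddSubgroup.mem_inf, mem_matrixBox, mem_matrixBox, AddSubgroup.mem_comap]
    change _ ↔ _ ∧ M 1 0 ∈ padicBall q l
    have := @padicBall_anti q _ _ _ hjl (M 1 0)
    tauto
  have e1 := relIndex_inf_comap_padicBall (map_entryHom_matrixBox_zero_one (q := q) i j) hik
  have e2 := relIndex_inf_comap_padicBall (map_entryHom_matrixBox_one_zero (q := q) k j) hjl
  rw [← h1] at e1
  rw [← h2] at e2
  rw [← AddSubgroup.relIndex_mul_relIndex _ _ _ (h2.trans_le inf_le_left)
    (h1.trans_le inf_le_left), e1, e2, ← pow_add]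
  congr 1
  lia

theorem relIndex_matrixBox_inf_comap_diagonalForm {i j k l d : ℤ} (hik : i ≤ k) (hjl : j ≤ l)
    (hk : 0 ≤ k) (hl : 0 ≤ l) (hd : 0 ≤ d) :
    (matrixBox q k l ⊓ (padicBall q d).comap (diagonalForm q)).relIndex (matrixBox q i j) =
      q ^ (k - i + (l - j) + d).toNat := by
  have h1 : matrixBox q k l ≤ matrixBox q i j := by
    rw [← inf_eq_right, matrixBox_inf, max_eq_right hik, max_eq_right hjl]
  rw [← AddSubgroup.relIndex_mul_relIndex _ _ _ inf_le_left h1, relIndex_matrixBox hik hjl,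
    relIndex_inf_comap_padicBall (map_diagonalForm_matrixBox hk hl) hd, ← pow_add]
  congr 1
  lia

/-- The orders of lattices `⟨s f₁, t f₂⟩` in coordinates. -/
theorem mem_latticeOrder_lowerGL_zero {s t : ℚ_[q]} (hs : s ≠ 0) (ht : t ≠ 0)
    (M : Matrix (Fin 2) (Fin 2) ℚ_[q]) :
    M ∈ latticeOrder (lowerGL s 0 t hs ht) ↔
      M ∈ matrixBox q (-(t.valuation - s.valuation)) (t.valuation - s.valuation) := by
  have h0 : (q : ℝ) ≠ 0 := (zero_lt_one.trans one_lt_cast_prime).ne'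
  have hs' : 0 < ‖s‖ := norm_pos_iff.2 hs
  have ht' : 0 < ‖t‖ := norm_pos_iff.2 ht
  have h1 : conjEquiv (lowerGL s 0 t hs ht) M = !![M 0 0, t / s * M 0 1; s / t * M 1 0, M 1 1] := by
    rw [mul_eq_iff_conjEquiv_eq, lowerGL_val]
    ext i j
    fin_cases i <;> fin_cases j <;> simp [Matrix.mul_apply] <;> field_simp
  have e1 : (q : ℝ) ^ (- -(t.valuation - s.valuation)) = ‖s‖ / ‖t‖ := by
    rw [Padic.norm_eq_zpow_neg_valuation hs, Padic.norm_eq_zpow_neg_valuation ht,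
      ← zpow_sub₀ h0]
    congr 1
    ring
  have e2 : (q : ℝ) ^ (-(t.valuation - s.valuation)) = ‖t‖ / ‖s‖ := by
    rw [Padic.norm_eq_zpow_neg_valuation hs, Padic.norm_eq_zpow_neg_valuation ht,
      ← zpow_sub₀ h0]
    congr 1
    ring
  rw [mem_latticeOrder, h1, mem_integralOrder_of, mem_matrixBox]
  simp only [mem_padicBall, e1, e2, neg_zero, zpow_zero, norm_mul, norm_div]
  have e3 : ‖t‖ / ‖s‖ * ‖M 0 1‖ ≤ 1 ↔ ‖M 0 1‖ ≤ ‖s‖ / ‖t‖ := by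
    rw [le_div_iff₀ ht', div_mul_eq_mul_div, div_le_one hs', mul_comm]
  have e4 : ‖s‖ / ‖t‖ * ‖M 1 0‖ ≤ 1 ↔ ‖M 1 0‖ ≤ ‖t‖ / ‖s‖ := by
    rw [le_div_iff₀ hs', div_mul_eq_mul_div, div_le_one ht', mul_comm]
  rw [e3, e4]
  tauto

/-- The order of the lattice `⟨f₁ + f₂, c f₂⟩` in coordinates. -/
theorem mem_matrixBox_and_mem_latticeOrder_lowerGL {c : ℚ_[q]} (hc : c ≠ 0) (hc1 : ‖c‖ ≤ 1)
    (i j : ℤ) (M : Matrix (Fin 2) (Fin 2) ℚ_[q]) :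
    M ∈ matrixBox q i j ∧ M ∈ latticeOrder (lowerGL 1 1 c one_ne_zero hc) ↔
      M ∈ matrixBox q (max i 0) (max j 0) ⊓ (padicBall q c.valuation).comap (diagonalForm q) := by
  have hc' : 0 < ‖c‖ := norm_pos_iff.2 hc
  have h1 : conjEquiv (lowerGL 1 1 c one_ne_zero hc) M =
      !![M 0 0 + M 0 1, c * M 0 1; diagonalForm q M / c, M 1 1 - M 0 1] := by
    rw [mul_eq_iff_conjEquiv_eq, lowerGL_val, diagonalForm_apply]
    ext i j
    fin_cases i <;> fin_cases j <;> simp [Matrix.mul_apply] <;> field_simp <;> ring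
  have hball : ∀ y : ℚ_[q], y ∈ padicBall q 0 ↔ ‖y‖ ≤ 1 := fun y => by
    rw [mem_padicBall, neg_zero, zpow_zero]
  have e1 : ‖diagonalForm q M / c‖ ≤ 1 ↔ diagonalForm q M ∈ padicBall q c.valuation := by
    rw [mem_padicBall, ← Padic.norm_eq_zpow_neg_valuation hc, norm_div, div_le_one hc']
  have hcv : 0 ≤ c.valuation := by
    rw [← neg_nonpos]
    rw [Padic.norm_eq_zpow_neg_valuation hc] at hc1
    exact (zpow_le_one_iff_right₀ one_lt_cast_prime).1 hc1
  rw [mem_latticeOrder, h1, mem_integralOrder_of, e1, AddSubgroup.mem_inf, mem_matrixBox,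
    mem_matrixBox, AddSubgroup.mem_comap, ← hball, ← hball, ← hball, ← padicBall_inf,
    ← padicBall_inf, AddSubgroup.mem_inf, AddSubgroup.mem_inf]
  constructor
  · rintro ⟨⟨hx, hw, hy, hz⟩, hxy, -, hd, -⟩
    -- The box makes `x` and `w` integral, so integrality of `x + y` gives that of `y`, and
    -- integrality of the form then gives that of `z`.
    have hy0 : M 0 1 ∈ padicBall q 0 := by
      have := sub_mem hxy hx
      rwa [add_sub_cancel_left] at this
    have hz0 : M 1 0 ∈ padicBall q 0 := by
      have := add_mem (add_mem (sub_mem (padicBall_anti hcv hd) hw) hx) hy0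
      rw [diagonalForm_apply] at this
      convert this using 1
      ring
    exact ⟨⟨hx, hw, ⟨hy, hy0⟩, hz, hz0⟩, hd⟩
  · rintro ⟨⟨hx, hw, ⟨hy, hy0⟩, hz, hz0⟩, hd⟩
    refine ⟨⟨hx, hw, hy, hz⟩, add_mem hx hy0, ?_, hd, sub_mem hw hy0⟩
    rw [hball, norm_mul]
    exact mul_le_one₀ hc1 (norm_nonneg _) ((hball _).1 hy0)

end

/-! ### Distances in the Bruhat-Tits graph -/

section

variable {q : ℕ} [Fact q.Prime]

theorem relIndex_comap_conjEquiv (g : GL (Fin 2) ℚ_[q])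
    (A B : AddSubgroup (Matrix (Fin 2) (Fin 2) ℚ_[q])) :
    (A.comap (conjEquiv g).toLinearMap.toAddMonoidHom).relIndex
      (B.comap (conjEquiv g).toLinearMap.toAddMonoidHom) = A.relIndex B := by
  rw [AddSubgroup.relIndex_comap,
    AddSubgroup.map_comap_eq_self_of_surjective (conjEquiv g).surjective]

theorem relIndex_eq_of_mem_iff {Λ Λ' : Subalgebra ℤ_[q] (Matrix (Fin 2) (Fin 2) ℚ_[q])}
    (g : GL (Fin 2) ℚ_[q]) {A B : AddSubgroup (Matrix (Fin 2) (Fin 2) ℚ_[q])}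
    (hA : ∀ M, M ∈ Λ ↔ conjEquiv g M ∈ A) (hB : ∀ M, M ∈ Λ' ↔ conjEquiv g M ∈ B) :
    Λ.toSubring.toAddSubgroup.relIndex Λ'.toSubring.toAddSubgroup = A.relIndex B := by
  rw [← relIndex_comap_conjEquiv g A B]
  congr 1
  · ext M
    exact hA M
  · ext M
    exact hB M

namespace MaxOrder

/-- `Λ₃` is described only after intersection with a box: its own conditions involve sums such as `x
+ y`, which separate into entries once `x` and `w` are known to be integral. -/
theorem exists_coordinates (Λ₁ Λ₂ Λ₃ : MaxOrder q) :
    ∃ (g : GL (Fin 2) ℚ_[q]) (m n d : ℤ), 0 ≤ d ∧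
      (∀ M, M ∈ Λ₁.1 ↔ conjEquiv g M ∈ matrixBox q (-m) m) ∧
      (∀ M, M ∈ Λ₂.1 ↔ conjEquiv g M ∈ matrixBox q (-n) n) ∧
      ∀ i j M, conjEquiv g M ∈ matrixBox q i j ∧ M ∈ Λ₃.1 ↔
        conjEquiv g M ∈
          matrixBox q (max i 0) (max j 0) ⊓ (padicBall q d).comap (diagonalForm q) := by
  obtain ⟨g₁, h₁⟩ := exists_eq_latticeOrder Λ₁.2
  obtain ⟨g₂, h₂⟩ := exists_eq_latticeOrder Λ₂.2
  obtain ⟨g₃, h₃⟩ := exists_eq_latticeOrder Λ₃.2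
  obtain ⟨g, s₁, t₁, s₂, t₂, c, hs₁, ht₁, hs₂, ht₂, hc, hc1, e₁, e₂, e₃⟩ :=
    exists_common_basis g₁ g₂ g₃
  refine ⟨g, t₁.valuation - s₁.valuation, t₂.valuation - s₂.valuation, c.valuation, ?_,
    fun M => ?_, fun M => ?_, fun i j M => ?_⟩
  · rw [← neg_nonpos]
    rw [Padic.norm_eq_zpow_neg_valuation hc] at hc1
    exact (zpow_le_one_iff_right₀ one_lt_cast_prime).1 hc1
  · rw [h₁, e₁, mem_latticeOrder_mul, mem_latticeOrder_lowerGL_zero]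
  · rw [h₂, e₂, mem_latticeOrder_mul, mem_latticeOrder_lowerGL_zero]
  · rw [h₃, e₃, mem_latticeOrder_mul, mem_matrixBox_and_mem_latticeOrder_lowerGL hc hc1]

theorem index_eq_of_matrixBox {g : GL (Fin 2) ℚ_[q]} {Λ₁ Λ₂ : MaxOrder q} {m n : ℤ}
    (h₁ : ∀ M, M ∈ Λ₁.1 ↔ conjEquiv g M ∈ matrixBox q (-m) m)
    (h₂ : ∀ M, M ∈ Λ₂.1 ↔ conjEquiv g M ∈ matrixBox q (-n) n) :
    index Λ₁ Λ₂ = q ^ (m - n).natAbs := by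
  have h : ∀ M, M ∈ Λ₁.1 ⊓ Λ₂.1 ↔ conjEquiv g M ∈ matrixBox q (max (-m) (-n)) (max m n) := by
    intro M
    rw [Algebra.mem_inf, h₁, h₂, ← matrixBox_inf, AddSubgroup.mem_inf]
  rw [index, relIndex_eq_of_mem_iff g h h₁, relIndex_matrixBox (le_max_left _ _) (le_max_left _ _)]
  congr 1
  lia

/-- Supplies the vertex at position `k` of the apartment; `Λ₀` serves only to transfer maximality.
-/
theorem exists_eq_matrixBox (Λ₀ : MaxOrder q) (g : GL (Fin 2) ℚ_[q]) (k : ℤ) :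
    ∃ Λ : MaxOrder q, ∀ M, M ∈ Λ.1 ↔ conjEquiv g M ∈ matrixBox q (-k) k := by
  obtain ⟨g₀, h₀⟩ := exists_eq_latticeOrder Λ₀.2
  refine ⟨⟨latticeOrder (g * lowerGL 1 0 ((q : ℚ_[q]) ^ k) one_ne_zero (prime_zpow_ne_zero k)),
    maximal_latticeOrder_of_maximal (h₀ ▸ Λ₀.2) _⟩, fun M => ?_⟩
  rw [mem_latticeOrder_mul, mem_latticeOrder_lowerGL_zero]
  simp [Padic.valuation_zpow]

theorem exists_walk_of_matrixBox {g : GL (Fin 2) ℚ_[q]} {Λ₁ : MaxOrder q} {m : ℤ}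
    (h₁ : ∀ M, M ∈ Λ₁.1 ↔ conjEquiv g M ∈ matrixBox q (-m) m) (l : ℕ) :
    ∀ Λ₂ : MaxOrder q, (∀ M, M ∈ Λ₂.1 ↔ conjEquiv g M ∈ matrixBox q (-(m + l)) (m + l)) →
      ∃ w : (bruhatTitsTree q).Walk Λ₁ Λ₂, w.length = l := by
  induction l with
  | zero =>
    intro Λ₂ h₂
    have : Λ₁ = Λ₂ := by
      apply Subtype.ext
      ext M
      rw [h₁, h₂]
      simp
    subst this
    exact ⟨SimpleGraph.Walk.nil, rfl⟩
  | succ l ih =>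
    intro Λ₂ h₂
    obtain ⟨Λ, h⟩ := exists_eq_matrixBox Λ₁ g (m + l)
    obtain ⟨w, hw⟩ := ih Λ h
    have hadj : (bruhatTitsTree q).Adj Λ Λ₂ := by
      constructor
      · rw [index_eq_of_matrixBox h h₂, show m + l - (m + (l + 1 : ℕ)) = -1 by lia]
        simp
      · rw [index_eq_of_matrixBox h₂ h, show m + (l + 1 : ℕ) - (m + l) = 1 by lia]
        simp
    exact ⟨w.concat hadj, by rw [SimpleGraph.Walk.length_concat, hw]⟩

/-- Along an edge the quotient `Λ / (Λ ∩ Λ')` has order `q`, so it is killed by `q`. This bounds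
walk lengths from below. -/
theorem prime_pow_nsmul_mem_of_walk {Λ Λ' : MaxOrder q} (w : (bruhatTitsTree q).Walk Λ Λ') :
    ∀ M ∈ Λ.1, q ^ w.length • M ∈ Λ'.1 := by
  induction w with
  | nil => simp
  | @cons Λ₁ Λ₂ Λ₃ hadj w ih =>
    intro M hM
    have h1 : q • M ∈ Λ₂.1 := by
      have h2 := AddSubgroup.nsmul_index_mem
        ((Λ₁.1 ⊓ Λ₂.1).toSubring.toAddSubgroup.addSubgroupOf Λ₁.1.toSubring.toAddSubgroup) ⟨M, hM⟩
      have h3 : ((Λ₁.1 ⊓ Λ₂.1).toSubring.toAddSubgroup.addSubgroupOf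
        Λ₁.1.toSubring.toAddSubgroup).index = q := hadj.1
      rw [h3, AddSubgroup.mem_addSubgroupOf] at h2
      exact h2.2
    have h4 := ih _ h1
    rwa [smul_smul, ← pow_succ] at h4

theorem le_length_of_matrixBox {g : GL (Fin 2) ℚ_[q]} {Λ₁ Λ₂ : MaxOrder q} {m n : ℤ}
    (h₁ : ∀ M, M ∈ Λ₁.1 ↔ conjEquiv g M ∈ matrixBox q (-m) m)
    (h₂ : ∀ M, M ∈ Λ₂.1 ↔ conjEquiv g M ∈ matrixBox q (-n) n)
    (w : (bruhatTitsTree q).Walk Λ₁ Λ₂) : (m - n).natAbs ≤ w.length := by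
  have key : ∀ N ∈ matrixBox q (-m) m, (q : ℚ_[q]) ^ w.length • N ∈ matrixBox q (-n) n := by
    intro N hN
    have h := prime_pow_nsmul_mem_of_walk w ((conjEquiv g).symm N)
      ((h₁ _).2 (by rwa [AlgEquiv.apply_symm_apply]))
    rw [h₂, map_nsmul, AlgEquiv.apply_symm_apply, ← Nat.cast_smul_eq_nsmul ℚ_[q]] at h
    simpa using h
  have key' : ∀ a b : ℤ, (q : ℚ_[q]) ^ w.length * (q : ℚ_[q]) ^ a ∈ padicBall q b →
      b ≤ w.length + a := by
    intro a b h
    have h0 : (q : ℚ_[q]) ≠ 0 := by exact_mod_cast (Fact.out : q.Prime).ne_zero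
    rw [← zpow_natCast, ← zpow_add₀ h0, mem_padicBall, norm_prime_zpow,
      zpow_le_zpow_iff_right₀ one_lt_cast_prime] at h
    lia
  have hz : ∀ a : ℤ, (q : ℚ_[q]) ^ a ∈ padicBall q a := fun a => (norm_prime_zpow a).le
  -- The extreme off-diagonal entries `q ^ (-m)` and `q ^ m` bound `m - n` and `n - m` respectively.
  have k1 := (mem_matrixBox.1 (key !![0, (q : ℚ_[q]) ^ (-m); 0, 0]
    (of_mem_matrixBox (zero_mem _) (hz _) (zero_mem _) (zero_mem _)))).2.2.1
  have k2 := (mem_matrixBox.1 (key !![0, 0; (q : ℚ_[q]) ^ m, 0]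
    (of_mem_matrixBox (zero_mem _) (zero_mem _) (hz _) (zero_mem _)))).2.2.2
  have k3 := key' _ _ k1
  have k4 := key' _ _ k2
  lia

theorem dist_eq_of_matrixBox {g : GL (Fin 2) ℚ_[q]} {Λ₁ Λ₂ : MaxOrder q} {m n : ℤ}
    (h₁ : ∀ M, M ∈ Λ₁.1 ↔ conjEquiv g M ∈ matrixBox q (-m) m)
    (h₂ : ∀ M, M ∈ Λ₂.1 ↔ conjEquiv g M ∈ matrixBox q (-n) n) :
    (bruhatTitsTree q).dist Λ₁ Λ₂ = (m - n).natAbs := by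
  obtain ⟨w, hw⟩ : ∃ w : (bruhatTitsTree q).Walk Λ₁ Λ₂, w.length = (m - n).natAbs := by
    rcases le_total m n with h | h
    · exact exists_walk_of_matrixBox h₁ _ Λ₂ (by rwa [show m + (m - n).natAbs = n by lia])
    · obtain ⟨w, hw⟩ := exists_walk_of_matrixBox h₂ (m - n).natAbs Λ₁
        (by rwa [show n + (m - n).natAbs = m by lia])
      exact ⟨w.reverse, by rw [SimpleGraph.Walk.length_reverse, hw]⟩
  -- `dist` is `0` between unreachable vertices, so a shortest walk exists only thanks to `w`.
  obtain ⟨w', hw'⟩ := SimpleGraph.Reachable.exists_walk_length_eq_dist ⟨w⟩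
  exact le_antisymm (hw ▸ SimpleGraph.dist_le w) (hw' ▸ le_length_of_matrixBox h₁ h₂ w')

/-- The index `[Λ : Λ ∩ Λ']` is `q ^ d(Λ, Λ')`. -/
theorem index_eq_pow_dist (Λ₁ Λ₂ : MaxOrder q) :
    index Λ₁ Λ₂ = q ^ (bruhatTitsTree q).dist Λ₁ Λ₂ := by
  -- The third order is irrelevant here; `Λ₂` merely fills its place.
  obtain ⟨g, m, n, -, -, h₁, h₂, -⟩ := exists_coordinates Λ₁ Λ₂ Λ₂
  rw [index_eq_of_matrixBox h₁ h₂, dist_eq_of_matrixBox h₁ h₂]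

/-! ### Perimeters and triple intersections -/

/-- The sum of the three distances between three maximal orders. -/
noncomputable def perimeter (Λ₁ Λ₂ Λ₃ : MaxOrder q) : ℕ :=
  (bruhatTitsTree q).dist Λ₁ Λ₂ + (bruhatTitsTree q).dist Λ₂ Λ₃ + (bruhatTitsTree q).dist Λ₃ Λ₁

theorem perimeter_rotate (Λ₁ Λ₂ Λ₃ : MaxOrder q) : perimeter Λ₂ Λ₃ Λ₁ = perimeter Λ₁ Λ₂ Λ₃ := by
  simp only [perimeter]
  ring

theorem dist_eq_of_index_eq {Λ₁ Λ₂ : MaxOrder q} {a : ℕ} (h : index Λ₁ Λ₂ = q ^ a) :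
    (bruhatTitsTree q).dist Λ₁ Λ₂ = a := by
  rw [index_eq_pow_dist] at h
  exact Nat.pow_right_injective (Fact.out : q.Prime).two_le h

/-- The index `[Λ₁ : Λ₁ ∩ Λ₂ ∩ Λ₃]` is `q` to half the perimeter. -/
theorem exists_relIndex_eq_pow (Λ₁ Λ₂ Λ₃ : MaxOrder q) :
    ∃ t : ℕ, perimeter Λ₁ Λ₂ Λ₃ = 2 * t ∧
      (Λ₁.1 ⊓ Λ₂.1 ⊓ Λ₃.1).toSubring.toAddSubgroup.relIndex Λ₁.1.toSubring.toAddSubgroup =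
        q ^ t := by
  obtain ⟨g, m, n, d, hd, h₁, h₂, h₃⟩ := exists_coordinates Λ₁ Λ₂ Λ₃
  have hpair : ∀ (Λ : MaxOrder q) (k : ℤ),
      (∀ M, M ∈ Λ.1 ↔ conjEquiv g M ∈ matrixBox q (-k) k) →
      (bruhatTitsTree q).dist Λ Λ₃ = (max (-k) 0 + max k 0 + d).toNat := by
    intro Λ k hk
    apply dist_eq_of_index_eq
    have h : ∀ M, M ∈ Λ.1 ⊓ Λ₃.1 ↔ conjEquiv g M ∈
        matrixBox q (max (-k) 0) (max k 0) ⊓ (padicBall q d).comap (diagonalForm q) := by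
      intro M
      rw [Algebra.mem_inf, hk, h₃]
    rw [index, relIndex_eq_of_mem_iff g h hk,
      relIndex_matrixBox_inf_comap_diagonalForm (le_max_left _ _) (le_max_left _ _)
        (le_max_right _ _) (le_max_right _ _) hd]
    congr 1
    lia
  have h : ∀ M, M ∈ Λ₁.1 ⊓ Λ₂.1 ⊓ Λ₃.1 ↔ conjEquiv g M ∈
      matrixBox q (max (max (-m) (-n)) 0) (max (max m n) 0) ⊓
        (padicBall q d).comap (diagonalForm q) := by
    intro M
    rw [Algebra.mem_inf, Algebra.mem_inf, h₁, h₂, ← AddSubgroup.mem_inf, matrixBox_inf, h₃]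
  refine ⟨(max (max (-m) (-n)) 0 + max (max m n) 0 + d).toNat, ?_, ?_⟩
  -- The sum is `|m - n| + (|m| + d) + (|n| + d)`, and `|m - n| + |m| + |n|` is twice the length of
  -- the hull of `m, n, 0`.
  · rw [perimeter, SimpleGraph.dist_comm (u := Λ₃), dist_eq_of_matrixBox h₁ h₂, hpair Λ₁ m h₁,
      hpair Λ₂ n h₂]
    lia
  · rw [relIndex_eq_of_mem_iff g h h₁,
      relIndex_matrixBox_inf_comap_diagonalForm ((le_max_left _ _).trans (le_max_left _ _))
        ((le_max_left _ _).trans (le_max_left _ _)) (le_max_right _ _) (le_max_right _ _) hd]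
    congr 1
    lia

/-- A larger subgroup of `Λ₁` has smaller index, and the index determines the perimeter. -/
theorem perimeter_le_of_inf_le {Λ₁ Λ₂ Λ₃ Λ Λ' : MaxOrder q} (h : Λ₁.1 ⊓ Λ₂.1 ⊓ Λ₃.1 ≤ Λ.1)
    (h' : Λ₁.1 ⊓ Λ₂.1 ⊓ Λ₃.1 ≤ Λ'.1) : perimeter Λ₁ Λ Λ' ≤ perimeter Λ₁ Λ₂ Λ₃ := by
  obtain ⟨t, ht, et⟩ := exists_relIndex_eq_pow Λ₁ Λ₂ Λ₃
  obtain ⟨s, hs, es⟩ := exists_relIndex_eq_pow Λ₁ Λ Λ'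
  have hle : Λ₁.1 ⊓ Λ₂.1 ⊓ Λ₃.1 ≤ Λ₁.1 ⊓ Λ.1 ⊓ Λ'.1 :=
    le_inf (le_inf (inf_le_left.trans inf_le_left) h) h'
  have hle' : (Λ₁.1 ⊓ Λ₂.1 ⊓ Λ₃.1).toSubring.toAddSubgroup ≤
      (Λ₁.1 ⊓ Λ.1 ⊓ Λ'.1).toSubring.toAddSubgroup := fun M hM => hle hM
  have hq := (Fact.out : q.Prime)
  -- Index `0` encodes an infinite index, so monotonicity requires the larger index to be nonzero.
  have := AddSubgroup.relIndex_le_of_le_left hle'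
    (by rw [et]; exact pow_ne_zero _ hq.ne_zero)
  rw [et, es, Nat.pow_le_pow_iff_right hq.one_lt] at this
  lia

theorem perimeter_le_of_mem {Λ₁ Λ₂ Λ₃ Λ Λ' Λ'' : MaxOrder q} (hΛ : Λ = Λ₁ ∨ Λ = Λ₂ ∨ Λ = Λ₃)
    (h' : Λ₁.1 ⊓ Λ₂.1 ⊓ Λ₃.1 ≤ Λ'.1) (h'' : Λ₁.1 ⊓ Λ₂.1 ⊓ Λ₃.1 ≤ Λ''.1) :
    perimeter Λ Λ' Λ'' ≤ perimeter Λ₁ Λ₂ Λ₃ := by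
  rcases hΛ with rfl | rfl | rfl
  · exact perimeter_le_of_inf_le h' h''
  · rw [← perimeter_rotate Λ₁]
    have e : Λ.1 ⊓ Λ₃.1 ⊓ Λ₁.1 = Λ₁.1 ⊓ Λ.1 ⊓ Λ₃.1 := by rw [inf_comm, ← inf_assoc]
    exact perimeter_le_of_inf_le (e ▸ h') (e ▸ h'')
  · rw [perimeter_rotate Λ]
    have e : Λ.1 ⊓ Λ₁.1 ⊓ Λ₂.1 = Λ₁.1 ⊓ Λ₂.1 ⊓ Λ.1 := by rw [inf_assoc, inf_comm]
    exact perimeter_le_of_inf_le (e ▸ h') (e ▸ h'')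

end MaxOrder

end

theorem lemma3 (q : ℕ) [Fact q.Prime] (S : Finset (MaxOrder q)) (Λ₁ Λ₂ Λ₃ Λ₄ : MaxOrder q)
    (hS : S = {Λ₁, Λ₂, Λ₃}) (h : Λ₁.1 ⊓ Λ₂.1 ⊓ Λ₃.1 ≤ Λ₄.1) :
    d₃ (S ∪ {Λ₄}) = d₃ S := by
  have hmem : ∀ Λ : MaxOrder q, Λ ∈ S ↔ Λ = Λ₁ ∨ Λ = Λ₂ ∨ Λ = Λ₃ := by simp [hS]
  have hle : ∀ Λ ∈ S ∪ {Λ₄}, Λ₁.1 ⊓ Λ₂.1 ⊓ Λ₃.1 ≤ Λ.1 := by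
    intro Λ hΛ
    rw [Finset.mem_union, hmem, Finset.mem_singleton] at hΛ
    rcases hΛ with (rfl | rfl | rfl) | rfl
    · exact inf_le_left.trans inf_le_left
    · exact inf_le_left.trans inf_le_right
    · exact inf_le_right
    · exact h
  apply le_antisymm
  · have hmax : MaxOrder.perimeter Λ₁ Λ₂ Λ₃ ≤ d₃ S := by
      have h1 : Λ₁ ∈ S := by simp [hS]
      have h2 : Λ₂ ∈ S := by simp [hS]
      have h3 : Λ₃ ∈ S := by simp [hS]
      exact Finset.le_sup_of_le h1 (Finset.le_sup_of_le h2 (Finset.le_sup_of_le h3 le_rfl))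
    refine Finset.sup_le fun Λ hΛ => Finset.sup_le fun Λ' hΛ' => Finset.sup_le fun Λ'' hΛ'' => ?_
    refine le_trans (?_ : MaxOrder.perimeter Λ Λ' Λ'' ≤ _) hmax
    -- Rotate a member of `S`, if there is one, to the front; otherwise all three orders equal `Λ₄`.
    by_cases c : Λ ∈ S
    · exact MaxOrder.perimeter_le_of_mem ((hmem _).1 c) (hle _ hΛ') (hle _ hΛ'')
    by_cases c' : Λ' ∈ S
    · rw [← MaxOrder.perimeter_rotate]
      exact MaxOrder.perimeter_le_of_mem ((hmem _).1 c') (hle _ hΛ'') (hle _ hΛ)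
    by_cases c'' : Λ'' ∈ S
    · rw [MaxOrder.perimeter_rotate Λ'']
      exact MaxOrder.perimeter_le_of_mem ((hmem _).1 c'') (hle _ hΛ) (hle _ hΛ')
    have e : ∀ Λ ∈ S ∪ {Λ₄}, Λ ∉ S → Λ = Λ₄ := fun Λ h1 h2 => by
      simpa [h2] using h1
    rw [e _ hΛ c, e _ hΛ' c', e _ hΛ'' c'']
    simp [MaxOrder.perimeter]
  · have hsub : S ⊆ S ∪ {Λ₄} := Finset.subset_union_left
    exact (Finset.sup_mono hsub).trans (Finset.sup_mono_fun fun _ _ =>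
      (Finset.sup_mono hsub).trans (Finset.sup_mono_fun fun _ _ => Finset.sup_mono hsub))
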